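/- Let $\mathcal T$ be an essentially small triangulated category. A thick subcategory of $\mathcal T$ is a full triangulated subcategory closed under direct summands (hence under isomorphisms). The thick subcategories form a lattice $\operatorname{Thick}\mathcal T$ under inclusion: the meet $\mathcal U\wedge\mathcal V$ is the intersection, and the join $\mathcal U\vee\mathcal V$ is the smallest thick subcategory containing $\mathcal U$ and $\mathcal V$. Two thick subcategories $\mathcal U,\mathcal V$ are called commuting if every morphism $U\to V$ and every morphism $V\to U$ with $U\in\mathcal U$ and $V\in\mathcal V$ factors through an object of $\mathcal U\wedge\mathcal V$. A thick subcategory $\mathcal U$ is called central if $\mathcal U$ and $\mathcal V$ are commuting for every $\mathcal V\in\operatorname{Thick}\mathcal T$. Let $\mathcal U,\mathcal V\in\operatorname{Thick}\mathcal T$ be central. Then $\mathcal U\vee\mathcal V$ and $\mathcal U\wedge\mathcal V$ are central. Moreover, for all $\mathcal W\in\operatorname{Thick}\mathcal T$, \[(\mathcal U\wedge\mathcal W)\vee(\mathcal V\wedge\mathcal W)=(\mathcal U\vee\mathcal V)\wedge\mathcal W\] and \[(\mathcal U\vee\mathcal W)\wedge(\mathcal V\vee\mathcal W)=(\mathcal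 U\wedge\mathcal V)\vee\mathcal W.\] Consequently the central thick subcategories form a sublattice of $\operatorname{Thick}\mathcal T$, and this sublattice is a distributive lattice. -/

import Mathlib

open CategoryTheory Limits Pretriangulated
open scoped ZeroObject

universe w v u

/-- A thick subcategory of a triangulated category `C`: a triangulated subcategory (given by its
class of objects) that is closed under direct summands. In a triangulated category retracts and
direct summands agree, and closure under retracts includes closure under isomorphisms. -/
@[ext]
structure ThickSubcategory (C : Type*) [Category* C] [HasZeroObject C] [HasShift C ℤ]
    [Preadditive C] [∀ n : ℤ, (shiftFunctor C n).Additive] [Pretriangulated C] where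
  /-- the class of objects of the subcategory -/
  obj : ObjectProperty C
  isTriangulated : obj.IsTriangulated
  isStableUnderRetracts : obj.IsStableUnderRetracts

namespace ThickSubcategory

variable {C : Type*} [Category* C] [HasZeroObject C] [HasShift C ℤ]
  [Preadditive C] [∀ n : ℤ, (shiftFunctor C n).Additive] [Pretriangulated C]

attribute [instance] isTriangulated isStableUnderRetracts

/-- Thick subcategories are ordered by inclusion. -/
instance : PartialOrder (ThickSubcategory C) :=
  PartialOrder.lift obj fun _ _ h => ThickSubcategory.ext h

theorem le_def {U V : ThickSubcategory C} : U ≤ V ↔ ∀ X, U.obj X → V.obj X := Iff.rfl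

/-- The intersection of a class of thick subcategories. -/
def inter (S : Set (ThickSubcategory C)) : ThickSubcategory C where
  obj X := ∀ U ∈ S, U.obj X
  isStableUnderRetracts := ⟨fun r h U hU => U.obj.prop_of_retract r (h U hU)⟩
  isTriangulated :=
    { exists_zero := ⟨0, isZero_zero C, fun U _ => U.obj.prop_of_isZero (isZero_zero C)⟩
      isStableUnderShiftBy := fun a => ⟨fun X h U hU => U.obj.le_shift a X (h U hU)⟩
      ext₂' := fun T hT h₁ h₃ => ObjectProperty.le_isoClosure _ _ fun U hU =>
        U.obj.ext_of_isTriangulatedClosed₂ T hT (h₁ U hU) (h₃ U hU) }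

/-- The smallest thick subcategory containing a class of objects. -/
def thick (P : ObjectProperty C) : ThickSubcategory C :=
  inter {U | ∀ X, P X → U.obj X}

/-- The lattice of thick subcategories: `U ⊓ V` is the intersection of `U` and `V`, and `U ⊔ V` is
the smallest thick subcategory containing `U` and `V`. -/
instance : Lattice (ThickSubcategory C) where
  inf U V :=
    { obj := fun X => U.obj X ∧ V.obj X
      isTriangulated := inferInstanceAs (U.obj ⊓ V.obj).IsTriangulated
      isStableUnderRetracts :=
        ⟨fun r h => ⟨U.obj.prop_of_retract r h.1, V.obj.prop_of_retract r h.2⟩⟩ }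
  inf_le_left _ _ _ h := h.1
  inf_le_right _ _ _ h := h.2
  le_inf _ _ _ h₁ h₂ X hX := ⟨h₁ X hX, h₂ X hX⟩
  sup U V := thick fun X => U.obj X ∨ V.obj X
  le_sup_left _ _ X hX _ hW := hW X (Or.inl hX)
  le_sup_right _ _ X hX _ hW := hW X (Or.inr hX)
  sup_le _ _ W h₁ h₂ _ hX := hX W fun Y hY => hY.elim (h₁ Y) (h₂ Y)

/-- A pair of thick subcategories `U`, `V` is commuting if every morphism between an object of `U`
and an object of `V`, in either direction, factors through an object of `U ⊓ V`. -/
def Commuting (U V : ThickSubcategory C) : Prop :=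
  ∀ X Y : C, U.obj X → V.obj Y →
    (∀ f : X ⟶ Y, ∃ (Z : C) (_ : (U ⊓ V).obj Z) (a : X ⟶ Z) (b : Z ⟶ Y), a ≫ b = f) ∧
    (∀ f : Y ⟶ X, ∃ (Z : C) (_ : (U ⊓ V).obj Z) (a : Y ⟶ Z) (b : Z ⟶ X), a ≫ b = f)

/-- A thick subcategory is central if it commutes with every thick subcategory. -/
def IsCentral (U : ThickSubcategory C) : Prop :=
  ∀ V : ThickSubcategory C, Commuting U V

end ThickSubcategory

namespace ThickSubcategory

open ObjectProperty

section

variable {C : Type*} [Category* C] [HasZeroObject C] [HasShift C ℤ]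
  [Preadditive C] [∀ n : ℤ, (shiftFunctor C n).Additive] [Pretriangulated C]
  {X₁ X₂ X₃ Y₁ Y₂ Y₃ : C} {f : X₁ ⟶ X₂} {g : X₂ ⟶ X₃} {h : X₃ ⟶ X₁⟦(1 : ℤ)⟧}
  {f' : Y₁ ⟶ Y₂} {g' : Y₂ ⟶ Y₃} {h' : Y₃ ⟶ Y₁⟦(1 : ℤ)⟧}

/-! Write `U * V` for `extensionProduct U.obj V.obj`: objects `X` in triangles `A ⟶ X ⟶ B ⟶ A⟦1⟧`
with `A` in `U`, `B` in `V`. If `U` and `V` commute, the octahedral axiom gives `V * U ≤ U * V`, so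
`U * V` is closed under extensions and `U ⊔ V` consists of its retracts. Maps between such an `X`
and an object of `W` are then treated one end of the triangle at a time, which gives centrality of
joins (`Commuting.sup`) and, with a retract criterion, distributivity (`Commuting.sup_inf_eq`). -/

lemma exists_hom₁ (hT : Triangle.mk f g h ∈ distTriang C) (hT' : Triangle.mk f' g' h' ∈ distTriang C)
    (b : X₂ ⟶ Y₂) (c : X₃ ⟶ Y₃) (comm : g ≫ c = b ≫ g') :
    ∃ a : X₁ ⟶ Y₁, f ≫ b = a ≫ f' ∧ h ≫ a⟦(1 : ℤ)⟧' = c ≫ h' :=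
  complete_distinguished_triangle_morphism₁ _ _ hT hT' b c comm

lemma exists_hom₂ (hT : Triangle.mk f g h ∈ distTriang C) (hT' : Triangle.mk f' g' h' ∈ distTriang C)
    (a : X₁ ⟶ Y₁) (c : X₃ ⟶ Y₃) (comm : h ≫ a⟦(1 : ℤ)⟧' = c ≫ h') :
    ∃ b : X₂ ⟶ Y₂, f ≫ b = a ≫ f' ∧ g ≫ c = b ≫ g' :=
  complete_distinguished_triangle_morphism₂ _ _ hT hT' a c comm

lemma exists_hom₃ (hT : Triangle.mk f g h ∈ distTriang C) (hT' : Triangle.mk f' g' h' ∈ distTriang C)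
    (a : X₁ ⟶ Y₁) (b : X₂ ⟶ Y₂) (comm : f ≫ b = a ≫ f') :
    ∃ c : X₃ ⟶ Y₃, g ≫ c = b ≫ g' ∧ h ≫ a⟦(1 : ℤ)⟧' = c ≫ h' :=
  complete_distinguished_triangle_morphism _ _ hT hT' a b comm

lemma exists_desc (hT : Triangle.mk f g h ∈ distTriang C) {Y : C} (k : X₂ ⟶ Y) (hk : f ≫ k = 0) :
    ∃ l : X₃ ⟶ Y, k = g ≫ l :=
  Triangle.yoneda_exact₂ _ hT k hk

lemma exists_lift (hT : Triangle.mk f g h ∈ distTriang C) {Y : C} (k : Y ⟶ X₂) (hk : k ≫ g = 0) :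
    ∃ l : Y ⟶ X₁, k = l ≫ f :=
  Triangle.coyoneda_exact₂ _ hT k hk

end

section

variable {C : Type*} [Category* C] [HasZeroObject C] [HasShift C ℤ]
  [Preadditive C] [∀ n : ℤ, (shiftFunctor C n).Additive] [Pretriangulated C]

/-- A morphism factors through an object of the thick subcategory `P`. -/
def FactorsThrough (P : ThickSubcategory C) {X Y : C} (f : X ⟶ Y) : Prop :=
  ∃ (Z : C) (_ : P.obj Z) (a : X ⟶ Z) (b : Z ⟶ Y), a ≫ b = f

lemma FactorsThrough.comp_left {P : ThickSubcategory C} {X Y : C} {f : X ⟶ Y}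
    (h : P.FactorsThrough f) {X' : C} (g : X' ⟶ X) : P.FactorsThrough (g ≫ f) := by
  obtain ⟨Z, hZ, a, b, rfl⟩ := h
  exact ⟨Z, hZ, g ≫ a, b, by simp⟩

lemma FactorsThrough.comp_right {P : ThickSubcategory C} {X Y : C} {f : X ⟶ Y}
    (h : P.FactorsThrough f) {Y' : C} (g : Y ⟶ Y') : P.FactorsThrough (f ≫ g) := by
  obtain ⟨Z, hZ, a, b, rfl⟩ := h
  exact ⟨Z, hZ, a, b ≫ g, by simp⟩

lemma FactorsThrough.mono {P Q : ThickSubcategory C} (hPQ : P ≤ Q) {X Y : C} {f : X ⟶ Y}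
    (h : P.FactorsThrough f) : Q.FactorsThrough f := by
  obtain ⟨Z, hZ, a, b, rfl⟩ := h
  exact ⟨Z, hPQ Z hZ, a, b, rfl⟩

lemma obj_biprod (P : ThickSubcategory C) {X Y : C} (hX : P.obj X) (hY : P.obj Y) :
    P.obj (X ⊞ Y) :=
  P.obj.ext_of_isTriangulatedClosed₂ _ (binaryBiproductTriangle_distinguished X Y) hX hY

lemma FactorsThrough.add {P : ThickSubcategory C} {X Y : C} {f g : X ⟶ Y}
    (hf : P.FactorsThrough f) (hg : P.FactorsThrough g) : P.FactorsThrough (f + g) := by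
  obtain ⟨Z, hZ, a, b, rfl⟩ := hf
  obtain ⟨Z', hZ', a', b', rfl⟩ := hg
  exact ⟨Z ⊞ Z', P.obj_biprod hZ hZ', biprod.lift a a', biprod.desc b b', by simp⟩

lemma obj_of_factorsThrough_id {P : ThickSubcategory C} {X : C}
    (h : P.FactorsThrough (𝟙 X)) : P.obj X := by
  obtain ⟨Z, hZ, a, b, hab⟩ := h
  exact P.obj.prop_of_retract ⟨a, b, hab⟩ hZ

/-- If `u` factors through `I` in `P`, then `X` is a retract of `E ⊞ J`, where `E` is an extension
of `J` by `I`. -/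
lemma obj_of_distTriang_of_factorsThrough {P : ThickSubcategory C} {K X J : C} {u : K ⟶ X}
    {p : X ⟶ J} {q : J ⟶ K⟦(1 : ℤ)⟧} (hT : Triangle.mk u p q ∈ distTriang C)
    (hu : P.FactorsThrough u) (hJ : P.obj J) : P.obj X := by
  obtain ⟨I, hI, h, g, hg⟩ := hu
  -- `E` is the pushout of the triangle along `h : K ⟶ I`.
  obtain ⟨E, hE, i, j, hT'⟩ := P.obj.distinguished_cocone_triangle₂ (q ≫ h⟦(1 : ℤ)⟧') hI hJ
  obtain ⟨s, hs, -⟩ := exists_hom₂ hT hT' h (𝟙 J) (by simp)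
  have hqu : q ≫ u⟦(1 : ℤ)⟧' = 0 := comp_distTriang_mor_zero₃₁ _ hT
  obtain ⟨t, ht, -⟩ := exists_hom₂ hT'
    (contractible_distinguished X) g 0 (by
      rw [Category.assoc, ← Functor.map_comp, hg, hqu, zero_comp])
  obtain ⟨r, hr⟩ := exists_desc hT (𝟙 X - s ≫ t) (by
    rw [Preadditive.comp_sub, reassoc_of% hs, ht]
    simp [hg])
  have : 𝟙 X = s ≫ t + p ≫ r := by rw [← hr]; abel
  refine obj_of_factorsThrough_id ?_
  rw [this]
  exact FactorsThrough.add ⟨E, hE, s, t, rfl⟩ ⟨J, hJ, p, r, rfl⟩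

namespace Commuting

variable {U V W : ThickSubcategory C}

lemma factorsThrough (h : Commuting U V) {X Y : C} (hX : U.obj X) (hY : V.obj Y) (f : X ⟶ Y) :
    (U ⊓ V).FactorsThrough f :=
  (h X Y hX hY).1 f

lemma factorsThrough' (h : Commuting U V) {X Y : C} (hX : U.obj X) (hY : V.obj Y) (f : Y ⟶ X) :
    (U ⊓ V).FactorsThrough f :=
  (h X Y hX hY).2 f

lemma symm (h : Commuting U V) : Commuting V U := fun X Y hX hY => by
  rw [inf_comm]
  exact ⟨h.factorsThrough' hY hX, h.factorsThrough hY hX⟩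

lemma of_le (h : U ≤ V) : Commuting U V := fun X _ hX _ =>
  ⟨fun f => ⟨X, ⟨hX, h X hX⟩, 𝟙 X, f, by simp⟩, fun f => ⟨X, ⟨hX, h X hX⟩, f, 𝟙 X, by simp⟩⟩

/-- Factor `f` on `A` through `I`, then the induced map from `B` to the cone of `I ⟶ Y` through `J`.
An extension `Z` of `J` by `I` carries `f` up to a map vanishing on `A`, which factors through `B`.
-/
lemma factorsThrough_of_extensionProduct (hU : Commuting U W) (hV : Commuting V W) {X Y : C}
    (hX : extensionProduct U.obj V.obj X) (hY : W.obj Y) (f : X ⟶ Y) :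
    ((U ⊔ V) ⊓ W).FactorsThrough f := by
  have hUW : U ⊓ W ≤ (U ⊔ V) ⊓ W := inf_le_inf_right _ le_sup_left
  have hVW : V ⊓ W ≤ (U ⊔ V) ⊓ W := inf_le_inf_right _ le_sup_right
  obtain ⟨A, B, p, q, r, hT, hA, hB⟩ := hX
  obtain ⟨I, hI, i₁, i₂, hi⟩ := hU.factorsThrough hA hY (p ≫ f)
  obtain ⟨Y', hY', y, d, hT'⟩ := W.obj.distinguished_cocone_triangle i₂ hI.2 hY
  obtain ⟨c, -, hc⟩ := exists_hom₃ hT hT' i₁ f hi.symm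
  obtain ⟨J, hJ, j₁, j₂, rfl⟩ := hV.factorsThrough hB hY' c
  obtain ⟨Z, hZ, m, n, hT''⟩ := ((U ⊔ V) ⊓ W).obj.distinguished_cocone_triangle₂
    (j₂ ≫ d) (hUW _ hI) (hVW _ hJ)
  obtain ⟨s, hs, -⟩ := exists_hom₂ hT hT'' i₁ j₁
    (by simpa using hc)
  obtain ⟨t, ht, -⟩ := exists_hom₂ hT'' hT' (𝟙 I) j₂
    (by simp)
  obtain ⟨g, hg⟩ := exists_desc hT (f - s ≫ t) (by
    rw [Preadditive.comp_sub, reassoc_of% hs, ht]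
    simp [hi])
  have : f = s ≫ t + q ≫ g := by rw [← hg]; abel
  rw [this]
  exact FactorsThrough.add ⟨Z, hZ, s, t, rfl⟩ (((hV.factorsThrough hB hY g).mono hVW).comp_left q)

lemma factorsThrough_of_extensionProduct' (hU : Commuting U W) (hV : Commuting V W) {X Y : C}
    (hX : extensionProduct U.obj V.obj X) (hY : W.obj Y) (f : Y ⟶ X) :
    ((U ⊔ V) ⊓ W).FactorsThrough f := by
  have hUW : U ⊓ W ≤ (U ⊔ V) ⊓ W := inf_le_inf_right _ le_sup_left
  have hVW : V ⊓ W ≤ (U ⊔ V) ⊓ W := inf_le_inf_right _ le_sup_right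
  obtain ⟨A, B, p, q, r, hT, hA, hB⟩ := hX
  obtain ⟨J, hJ, j₁, j₂, hj⟩ := hV.factorsThrough' hB hY (f ≫ q)
  obtain ⟨Y', hY', y, d, hT'⟩ := W.obj.distinguished_cocone_triangle₁ j₁ hY hJ.2
  obtain ⟨a, -, ha⟩ := exists_hom₁ hT' hT f j₂ hj
  obtain ⟨I, hI, i₁, i₂, rfl⟩ := hU.factorsThrough' hA hY' a
  obtain ⟨Z, hZ, m, n, hT''⟩ := ((U ⊔ V) ⊓ W).obj.distinguished_cocone_triangle₂
    (d ≫ i₁⟦(1 : ℤ)⟧') (hUW _ hI) (hVW _ hJ)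
  obtain ⟨s, -, hs⟩ := exists_hom₂ hT' hT'' i₁ (𝟙 J)
    (by simp)
  obtain ⟨t, -, ht⟩ := exists_hom₂ hT'' hT i₂ j₂
    (by simpa using ha)
  obtain ⟨g, hg⟩ := exists_lift hT (f - s ≫ t) (by
    rw [Preadditive.sub_comp, Category.assoc, ← ht, ← reassoc_of% hs]
    simp [hj])
  have : f = s ≫ t + g ≫ p := by rw [← hg]; abel
  rw [this]
  exact FactorsThrough.add ⟨Z, hZ, s, t, rfl⟩
    (((hU.factorsThrough' hA hY g).mono hUW).comp_right p)

end Commuting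

lemma IsCentral.inf {U V : ThickSubcategory C} (hU : U.IsCentral) (hV : V.IsCentral) :
    (U ⊓ V).IsCentral := fun W X Y hX hY => by
  have hle : V ⊓ (U ⊓ W) ≤ U ⊓ V ⊓ W :=
    le_inf (le_inf (inf_le_right.trans inf_le_left) inf_le_left) (inf_le_right.trans inf_le_right)
  constructor
  · intro f
    obtain ⟨I, hI, a, b, rfl⟩ := (hU W).factorsThrough hX.1 hY f
    -- Centrality of `V` is used against `U ⊓ W`, so the second factorization stays inside `U` and
    -- `W`.
    exact (((hV (U ⊓ W)).factorsThrough hX.2 hI a).mono hle).comp_right b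
  · intro f
    obtain ⟨I, hI, a, b, rfl⟩ := (hU W).factorsThrough' hX.1 hY f
    exact (((hV (U ⊓ W)).factorsThrough' hX.2 hI b).mono hle).comp_left a

end

/-! ### Joins of commuting thick subcategories, via the octahedral axiom -/

section

variable {C : Type*} [Category* C] [HasZeroObject C] [HasShift C ℤ]
  [Preadditive C] [∀ n : ℤ, (shiftFunctor C n).Additive] [Pretriangulated C] [IsTriangulated C]

namespace Commuting

variable {U V W : ThickSubcategory C}

/-- The connecting map `A ⟶ B⟦1⟧` factors through `U ⊓ V`; the octahedron exhibits its fibre `Y` as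
an extension of the fibres of the two factors. -/
lemma extensionProduct_le (h : Commuting U V) :
    extensionProduct V.obj U.obj ≤ extensionProduct U.obj V.obj := by
  rintro Y ⟨B, A, f, g, k, hT, hB, hA⟩
  have hB' : V.obj (B⟦(1 : ℤ)⟧) := V.obj.le_shift 1 _ hB
  obtain ⟨I, hI, a, b, hab⟩ := h.factorsThrough hA hB' k
  obtain ⟨M, hM, _, _, hTa⟩ := U.obj.distinguished_cocone_triangle₁ a hA hI.1
  obtain ⟨N, hN, _, _, hTb⟩ := V.obj.distinguished_cocone_triangle₁ b hI.2 hB'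
  exact ⟨_, _, _, _, _, (Triangulated.someOctahedron' hab hTa hTb (rot_of_distTriang _ hT)).mem,
    hM, hN⟩

lemma extensionProduct_extensionProduct_le (h : Commuting U V) :
    extensionProduct (extensionProduct U.obj V.obj) (extensionProduct U.obj V.obj) ≤
      extensionProduct U.obj V.obj := by
  have hUU : extensionProduct U.obj U.obj ≤ U.obj :=
    extensionProduct_le_of_isTriangulatedClosed₂ le_rfl le_rfl
  have hVV : extensionProduct V.obj V.obj ≤ V.obj :=
    extensionProduct_le_of_isTriangulatedClosed₂ le_rfl le_rfl
  calc _ = extensionProduct U.obj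
        (extensionProduct (extensionProduct V.obj U.obj) V.obj) := by
        simp only [extensionProduct_assoc]
    _ ≤ extensionProduct U.obj (extensionProduct (extensionProduct U.obj V.obj) V.obj) :=
        monotone_extensionProduct_right _
          (monotone_extensionProduct_left _ h.extensionProduct_le)
    _ = extensionProduct (extensionProduct U.obj U.obj) (extensionProduct V.obj V.obj) := by
        simp only [extensionProduct_assoc]
    _ ≤ _ := (monotone_extensionProduct_left _ hUU).trans (monotone_extensionProduct_right _ hVV)

/-- The objects of the join of commuting thick subcategories `U` and `V` are the retracts of
extensions of objects of `V` by objects of `U`. -/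
lemma sup_obj_le (h : Commuting U V) :
    (U ⊔ V).obj ≤ (extensionProduct U.obj V.obj).retractClosure := by
  let E := extensionProduct U.obj V.obj
  have hUE : U.obj ≤ E := le_extensionProduct_left _
  have hVE : V.obj ≤ E := le_extensionProduct_right _
  let R : ThickSubcategory C :=
    { obj := E.retractClosure
      isStableUnderRetracts := inferInstance
      isTriangulated :=
        { exists_zero := ⟨0, isZero_zero C, le_retractClosure _ _
            (hUE _ (U.obj.prop_of_isZero (isZero_zero C)))⟩
          isStableUnderShiftBy := fun a => ⟨by
            rintro X ⟨Y, hY, ⟨r⟩⟩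
            exact ⟨_, E.le_shift a _ hY, ⟨r.map (shiftFunctor C a)⟩⟩⟩
          ext₂' := fun T hT h₁ h₃ => ObjectProperty.le_isoClosure _ _
            (monotone_retractClosure h.extensionProduct_extensionProduct_le _
              (extensionProduct_retractClosure_retractClosure_le _ _ _
                ⟨_, _, _, _, _, hT, h₁, h₃⟩)) } }
  have hle : U ⊔ V ≤ R := sup_le (fun X hX => le_retractClosure _ _ (hUE X hX))
    (fun X hX => le_retractClosure _ _ (hVE X hX))
  exact hle

lemma sup (h : Commuting U V) (hU : Commuting U W) (hV : Commuting V W) :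
    Commuting (U ⊔ V) W := fun X Y hX hY => by
  obtain ⟨X', hX', ⟨r⟩⟩ := h.sup_obj_le X hX
  constructor
  · intro f
    have := (hU.factorsThrough_of_extensionProduct hV hX' hY (r.r ≫ f)).comp_left r.i
    rwa [r.retract_assoc] at this
  · intro f
    have := (hU.factorsThrough_of_extensionProduct' hV hX' hY (f ≫ r.i)).comp_right r.r
    rwa [Category.assoc, r.retract, Category.comp_id] at this

lemma sup_inf_eq (h : Commuting U V) (hU : Commuting U W) (hV : Commuting V W) :
    (U ⊔ V) ⊓ W = (U ⊓ W) ⊔ (V ⊓ W) := by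
  refine le_antisymm ?_ (sup_le (inf_le_inf_right _ le_sup_left) (inf_le_inf_right _ le_sup_right))
  rintro X ⟨hX, hXW⟩
  obtain ⟨X', ⟨A, B, p, q, r, hT, hA, hB⟩, ⟨ρ⟩⟩ := h.sup_obj_le X hX
  obtain ⟨J, hJ, j₁, j₂, hj⟩ := hV.factorsThrough' hB hXW (ρ.i ≫ q)
  -- The fibre `K` lies in `W`, and `K ⟶ X ⟶ X'` dies in `B`, so it lifts to `A` and `u` factors
  -- through `U ⊓ W`.
  obtain ⟨K, hK, u, d, hT'⟩ := W.obj.distinguished_cocone_triangle₁ j₁ hXW hJ.2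
  have huj : u ≫ j₁ = 0 := comp_distTriang_mor_zero₁₂ _ hT'
  obtain ⟨g, hg⟩ := exists_lift hT (u ≫ ρ.i) (by
    rw [Category.assoc, ← hj, reassoc_of% huj, zero_comp])
  have hu : u = g ≫ p ≫ ρ.r := by
    rw [← Category.assoc, ← hg, Category.assoc, ρ.retract, Category.comp_id]
  refine obj_of_distTriang_of_factorsThrough hT' ?_
    (le_sup_right (a := U ⊓ W) (b := V ⊓ W) J hJ)
  rw [hu]
  exact ((hU.factorsThrough' hA hK g).mono le_sup_left).comp_right _

end Commuting

namespace IsCentral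

variable {U V : ThickSubcategory C}

lemma sup (hU : U.IsCentral) (hV : V.IsCentral) : (U ⊔ V).IsCentral := fun W =>
  (hU V).sup (hU W) (hV W)

/-- Distribute `V ⊔ W` over `U ⊔ W`, then `U` over `V ⊔ W`, and absorb `W ⊓ U` into `W`; comparable
subcategories commute, so `W` itself need not be central. -/
lemma sup_inf_sup_eq (hU : U.IsCentral) (hV : V.IsCentral) (W : ThickSubcategory C) :
    (U ⊔ W) ⊓ (V ⊔ W) = (U ⊓ V) ⊔ W := by
  rw [(hU W).sup_inf_eq (hU _) (Commuting.of_le le_sup_right), inf_comm U,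
    (hV W).sup_inf_eq (hU V).symm (hU W).symm, inf_eq_left.2 (le_sup_right : W ≤ V ⊔ W),
    sup_assoc, sup_eq_right.2 (inf_le_left : W ⊓ U ≤ W), inf_comm]

end IsCentral

end

end ThickSubcategory

theorem mainTheorem3 {C : Type u} [Category.{v} C] [EssentiallySmall.{w} C]
    [HasZeroObject C] [HasShift C ℤ] [Preadditive C] [∀ n : ℤ, (shiftFunctor C n).Additive]
    [Pretriangulated C] [IsTriangulated C] :
    (∀ U V : ThickSubcategory C, U.IsCentral → V.IsCentral →
      (U ⊔ V).IsCentral ∧ (U ⊓ V).IsCentral ∧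
      ∀ W : ThickSubcategory C,
        (U ⊓ W) ⊔ (V ⊓ W) = (U ⊔ V) ⊓ W ∧
        (U ⊔ W) ⊓ (V ⊔ W) = (U ⊓ V) ⊔ W) ∧
    ∃ Z : Sublattice (ThickSubcategory C),
      (Z : Set (ThickSubcategory C)) = {U | U.IsCentral} ∧
      ∀ x y z : Z, (x ⊓ z) ⊔ (y ⊓ z) = (x ⊔ y) ⊓ z := by
  refine ⟨fun U V hU hV => ⟨hU.sup hV, hU.inf hV, fun W =>
    ⟨((hU V).sup_inf_eq (hU W) (hV W)).symm, hU.sup_inf_sup_eq hV W⟩⟩,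
    ⟨{U | U.IsCentral}, fun _ hU _ hV => hU.sup hV, fun _ hU _ hV => hU.inf hV⟩, rfl, ?_⟩
  rintro ⟨x, hx⟩ ⟨y, hy⟩ ⟨z, hz⟩
  exact Subtype.ext ((hx y).sup_inf_eq (hx z) (hy z)).symm
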